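/- Let $\mathcal M,\mathcal X\subseteq\mathbb R$, let $\nu$ be a $\sigma$-finite measure on $\mathcal X$ (Borel $\sigma$-algebra), and let $(P_\mu)_{\mu\in\mathcal M}$ be probability measures on $\mathcal X$ with densities $p_\mu=dP_\mu/d\nu$ such that $(\mu,x)\mapsto p_\mu(x)$ is jointly measurable. Assume that the family is strictly totally positive of order 3 (STP$_3$): for every $n\in\{1,2,3\}$, all $\mu_1<\dots<\mu_n$ in $\mathcal M$ and all $x_1<\dots<x_n$ in $\mathcal X$, $\det[p_{\mu_i}(x_j)]_{i,j=1}^n>0$. Fix $\Delta^-<\Delta^+$ in $\mathcal M$, let $H_0=\{P_\mu:\mu\le\Delta^-\text{ or }\mu\ge\Delta^+\}$, let $w$ be a probability measure on $\{\mu\in\mathcal M:\Delta^-<\mu<\Delta^+\}$, let $Q=\int P_\mu\,dw(\mu)$, and let $q\ge 0$ be a density of $Q$ with respect to $\nu$. Let $\mathcal E$ be the set of valid e-values for $H_0$, i.e. of measurable $\varepsilon:\mathcal X\to[0,\infty]$ with $\mathbb E_{P}[\varepsilon]\le 1$ for all $P\in H_0$. For $c\in(0,1)$ put $$\varepsilon_c(x)=\frac{q(x)}{c\,p_{\Delta^-}(x)+(1-c)\,p_{\Delta^+}(x)}.$$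 Then there is $c^*\in(0,1)$ with $\mathbb E_{P_{\Delta^-}}[\varepsilon_{c^*}]=\mathbb E_{P_{\Delta^+}}[\varepsilon_{c^*}]=1$. Moreover, for every such $c^*$, $\varepsilon_{c^*}$ is the log-optimal e-value: $\varepsilon_{c^*}\in\mathcal E$, the expectation $\mathbb E_Q[\log\varepsilon]$ is well defined in $[-\infty,\infty]$ for every $\varepsilon\in\mathcal E$, $\mathbb E_Q[\log\varepsilon]\le\mathbb E_Q[\log\varepsilon_{c^*}]$ for every $\varepsilon\in\mathcal E$, and every maximizer of $\mathbb E_Q[\log\varepsilon]$ over $\mathcal E$ equals $\varepsilon_{c^*}$ $Q$-almost surely. -/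

import Mathlib

open MeasureTheory
open scoped ENNReal

/-- Strict total positivity of order `r` of a kernel `(μ, x) ↦ p μ x` on totally ordered sets:
all minors of size `n ∈ {1, …, r}` along increasing parameters and points are positive. -/
def IsSTP (r : ℕ) {M X : Type*} [LinearOrder M] [LinearOrder X] (p : M → X → ℝ) : Prop :=
  ∀ n : ℕ, 1 ≤ n → n ≤ r → ∀ (μ : Fin n → M) (x : Fin n → X), StrictMono μ → StrictMono x →
    0 < (Matrix.of fun i j : Fin n => p (μ i) (x j)).det

/-- The two-sided equivalence null hypothesis `{P_μ : μ ≤ Δ⁻ or μ ≥ Δ⁺}`. -/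
def equivalenceNull {M X : Type*} [LinearOrder M] [MeasurableSpace X]
    (P : M → Measure X) (Δm Δp : M) : Set (Measure X) :=
  P '' {μ | μ ≤ Δm ∨ Δp ≤ μ}

/-- `ε` is a valid e-value for the hypothesis `H`: a measurable statistic with values in `[0, ∞]`
whose expectation is at most one under every member of `H`. -/
def IsEValue {X : Type*} [MeasurableSpace X] (H : Set (Measure X)) (ε : X → ℝ≥0∞) : Prop :=
  Measurable ε ∧ ∀ P ∈ H, ∫⁻ x, ε x ∂P ≤ 1

/-- The expectation of an extended real function is well defined: its positive and negative parts
do not both have infinite integral. -/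
def HasExpectation {X : Type*} [MeasurableSpace X] (Q : Measure X) (f : X → EReal) : Prop :=
  ∫⁻ x, (f x).toENNReal ∂Q ≠ ∞ ∨ ∫⁻ x, (-f x).toENNReal ∂Q ≠ ∞

/-- The expectation of an extended real function, as the integral of the positive part minus the
integral of the negative part. It is meaningful when `HasExpectation Q f` holds. -/
noncomputable def expectation {X : Type*} [MeasurableSpace X] (Q : Measure X) (f : X → EReal) :
    EReal :=
  ((∫⁻ x, (f x).toENNReal ∂Q : ℝ≥0∞) : EReal) - ((∫⁻ x, (-f x).toENNReal ∂Q : ℝ≥0∞) : EReal)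

/-- `ε` is a maximizer of the expected utility `E_Q[U(·)]` over all valid e-values for `H`, where
the expected utility of every valid e-value is well defined. -/
def IsUtilityOptimal {X : Type*} [MeasurableSpace X] (H : Set (Measure X)) (Q : Measure X)
    (U : ℝ≥0∞ → EReal) (ε : X → ℝ≥0∞) : Prop :=
  IsEValue H ε ∧
    ∀ ε' : X → ℝ≥0∞, IsEValue H ε' →
      HasExpectation Q (fun x => U (ε' x)) ∧
        expectation Q (fun x => U (ε' x)) ≤ expectation Q (fun x => U (ε x))

/-- The likelihood ratio `q / (c p⁻ + (1 - c) p⁺)` of `q` against a mixture of `p⁻` and `p⁺`. -/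
noncomputable def mixtureLR {X : Type*} (q pm pp : X → ℝ) (c : ℝ) (x : X) : ℝ≥0∞ :=
  ENNReal.ofReal (q x / (c * pm x + (1 - c) * pp x))

/-! # The log-optimal e-value for a two-sided equivalence hypothesis

Write `a = p Δm`, `b = p Δp`, `m = c a + (1 - c) b` and `ε = q / m`.

*Optimality.* For every e-value `ε'`, `E_Q[ε' / ε]` is at most the expectation of `ε'` under the
mixture of `P Δm` and `P Δp`, hence at most one. By `log t ≤ t - 1` with its equality case, such an
`ε` is the unique maximizer of `E_Q[log ε]` as soon as it is itself an e-value
(`isUtilityOptimal_log_of_numeraire`). Total positivity of order two makes `q / a` increasing and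
`q / b` decreasing, so `ε` is bounded (`exists_div_mixture_le`) and no infinite expectations
interfere.

*Validity.* Total positivity of order three, integrated over the mixing measure, shows that `ε - 1`
has the sign pattern `-, +, -`. Since `ε - 1` has mean zero under both boundary laws, a
determinantal form of variation diminution (`integral_mul_nonpos_of_sign_pattern`) makes its mean
nonpositive under every law outside the interval.

*Existence of `c`.* The means of `ε` under `P Δm` and `P Δp`, weighted by `c` and `1 - c`, add up
to one and depend continuously on `c`. Neither stays below one on `(0, 1)`: in the limit this would
contradict Chebyshev's inequality for similarly ordered functions
(`exists_one_le_integral_mul_div_mixture`). The intermediate value theorem gives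
`exists_integral_mul_div_mixture_eq_one`.
-/

/-! ### Log-optimality of a numéraire -/

lemma toENNReal_log_le (y : ℝ≥0∞) : (ENNReal.log y).toENNReal ≤ y := by
  induction y using ENNReal.recTopCoe with
  | top => simp
  | coe y =>
    rcases eq_or_ne y 0 with rfl | hy
    · simp
    · rw [ENNReal.log_pos_real (by simpa using hy) (by simp), EReal.toENNReal_of_ne_top (by simp),
        EReal.toReal_coe, ← ENNReal.ofReal_coe_nnreal]
      have : 0 < (y : ℝ) := by positivity
      apply ENNReal.ofReal_le_ofReal
      simpa using (Real.log_le_sub_one_of_pos this).trans (sub_le_self _ zero_le_one)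

/-- When positive and negative part of `log ε` are integrable, the extended expectation is
a Bochner integral. -/
lemma expectation_log_eq {X : Type*} [MeasurableSpace X] {Q : Measure X} {ε : X → ℝ≥0∞}
    (hε : Measurable ε) (h0 : ∀ᵐ x ∂Q, ε x ≠ 0) (htop : ∀ᵐ x ∂Q, ε x ≠ ∞)
    (hpos : ∫⁻ x, (ENNReal.log (ε x)).toENNReal ∂Q ≠ ∞)
    (hneg : ∫⁻ x, (-ENNReal.log (ε x)).toENNReal ∂Q ≠ ∞) :
    Integrable (fun x => Real.log (ε x).toReal) Q ∧
      expectation Q (fun x => ENNReal.log (ε x)) = ((∫ x, Real.log (ε x).toReal ∂Q : ℝ) : EReal) := by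
  have h1 : ∫⁻ x, (ENNReal.log (ε x)).toENNReal ∂Q
      = ∫⁻ x, ENNReal.ofReal (Real.log (ε x).toReal) ∂Q := by
    refine lintegral_congr_ae ?_
    filter_upwards [h0, htop] with x h0 htop
    rw [ENNReal.log_pos_real h0 htop, EReal.toENNReal_of_ne_top (by simp), EReal.toReal_coe]
  have h2 : ∫⁻ x, (-ENNReal.log (ε x)).toENNReal ∂Q
      = ∫⁻ x, ENNReal.ofReal (-Real.log (ε x).toReal) ∂Q := by
    refine lintegral_congr_ae ?_
    filter_upwards [h0, htop] with x h0 htop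
    rw [ENNReal.log_pos_real h0 htop, ← EReal.coe_neg, EReal.toENNReal_of_ne_top (by simp),
      EReal.toReal_coe]
  have hm : Measurable fun x => Real.log (ε x).toReal := by fun_prop
  have hint : Integrable (fun x => Real.log (ε x).toReal) Q := by
    refine ⟨hm.aestronglyMeasurable, ?_⟩
    rw [hasFiniteIntegral_iff_norm]
    have : ∀ x, ENNReal.ofReal ‖Real.log (ε x).toReal‖ ≤
        ENNReal.ofReal (Real.log (ε x).toReal) + ENNReal.ofReal (-Real.log (ε x).toReal) := by
      intro x
      rw [Real.norm_eq_abs]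
      rcases abs_cases (Real.log (ε x).toReal) with h | h <;> rw [h.1] <;> simp
    refine (lintegral_mono this).trans_lt ?_
    rw [lintegral_add_left (by fun_prop), ← h1, ← h2]
    exact ENNReal.add_lt_top.2 ⟨hpos.lt_top, hneg.lt_top⟩
  refine ⟨hint, ?_⟩
  rw [integral_eq_lintegral_pos_part_sub_lintegral_neg_part hint, ← h1, ← h2, expectation,
    EReal.coe_sub, EReal.coe_ennreal_toReal hpos, EReal.coe_ennreal_toReal hneg]

/-- An e-value `ε` with `E_Q[ε' / ε] ≤ 1` for all e-values `ε'` is log-optimal, by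
`log t ≤ t - 1` at `t = ε' / ε`; the equality case of this inequality gives uniqueness. Boundedness
of `ε` keeps `E_Q[log ε]` finite and all the expected logarithms well defined. -/
theorem isUtilityOptimal_log_of_numeraire {X : Type*} [MeasurableSpace X] {H : Set (Measure X)}
    (hH : ∀ P ∈ H, IsProbabilityMeasure P) {Q : Measure X} [IsProbabilityMeasure Q]
    {ε : X → ℝ≥0∞} (hε : IsEValue H ε) (h0 : ∀ᵐ x ∂Q, ε x ≠ 0)
    {K : ℝ≥0∞} (hK : K ≠ ∞) (hεK : ∀ᵐ x ∂Q, ε x ≤ K)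
    (hnum : ∀ ε', IsEValue H ε' → ∫⁻ x, ε' x / ε x ∂Q ≤ 1) :
    IsUtilityOptimal H Q ENNReal.log ε ∧
      ∀ ε', IsUtilityOptimal H Q ENNReal.log ε' → ε' =ᵐ[Q] ε := by
  have htop : ∀ᵐ x ∂Q, ε x ≠ ∞ := hεK.mono fun x hx => (hx.trans_lt hK.lt_top).ne
  have hbd : ∀ ε', IsEValue H ε' → ∫⁻ x, ε' x ∂Q ≠ ∞ := by
    intro ε' hε'
    have : ∫⁻ x, ε' x ∂Q ≤ ∫⁻ x, K * (ε' x / ε x) ∂Q := by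
      refine lintegral_mono_ae ?_
      filter_upwards [h0, htop, hεK] with x h0 htop hx
      calc ε' x = ε x * (ε' x / ε x) := (ENNReal.mul_div_cancel h0 htop).symm
        _ ≤ _ := by gcongr
    have hm : Measurable fun x => ε' x / ε x := hε'.1.div hε.1
    rw [lintegral_const_mul _ hm] at this
    refine (this.trans_lt (ENNReal.mul_lt_top hK.lt_top ?_)).ne
    exact (hnum ε' hε').trans_lt ENNReal.one_lt_top
  have hpos : ∀ ε', IsEValue H ε' → ∫⁻ x, (ENNReal.log (ε' x)).toENNReal ∂Q ≠ ∞ :=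
    fun ε' hε' => ((lintegral_mono fun x => toENNReal_log_le _).trans_lt (hbd ε' hε').lt_top).ne
  -- The constant `1` is an e-value, so `1 / ε` is `Q`-integrable and dominates the negative part.
  have hneg : ∫⁻ x, (-ENNReal.log (ε x)).toENNReal ∂Q ≠ ∞ := by
    have h1 : IsEValue H fun _ => (1 : ℝ≥0∞) :=
      ⟨measurable_const, fun P hP => by have := hH P hP; simp⟩
    refine ((lintegral_mono fun x => ?_).trans_lt ((hnum _ h1).trans_lt ENNReal.one_lt_top)).ne
    rw [← ENNReal.log_inv, one_div]
    exact toENNReal_log_le _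
  obtain ⟨hint, hE⟩ := expectation_log_eq hε.1 h0 htop (hpos ε hε) hneg
  have key : ∀ ε', IsEValue H ε' →
      ∫⁻ x, (-ENNReal.log (ε' x)).toENNReal ∂Q ≠ ∞ →
      expectation Q (fun x => ENNReal.log (ε' x)) ≤ expectation Q (fun x => ENNReal.log (ε x)) ∧
      (expectation Q (fun x => ENNReal.log (ε x)) ≤ expectation Q (fun x => ENNReal.log (ε' x)) →
        ε' =ᵐ[Q] ε) := by
    intro ε' hε' hneg'
    have h0' : ∀ᵐ x ∂Q, ε' x ≠ 0 := by
      have hm : Measurable fun x => (-ENNReal.log (ε' x)).toENNReal := by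
        have := hε'.1
        simp_rw [← ENNReal.log_inv]
        fun_prop
      filter_upwards [ae_lt_top hm hneg'] with x hx h
      simp [h] at hx
    have htop' : ∀ᵐ x ∂Q, ε' x ≠ ∞ :=
      (ae_lt_top hε'.1 (hbd ε' hε')).mono fun x hx => hx.ne
    obtain ⟨hint', hE'⟩ := expectation_log_eq hε'.1 h0' htop' (hpos ε' hε') hneg'
    have hRm : Measurable fun x => ε' x / ε x := hε'.1.div hε.1
    have hRint : Integrable (fun x => (ε' x / ε x).toReal) Q :=
      integrable_toReal_of_lintegral_ne_top hRm.aemeasurable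
        ((hnum ε' hε').trans_lt ENNReal.one_lt_top).ne
    have hR1 : ∫ x, (ε' x / ε x).toReal ∂Q ≤ 1 := by
      rw [integral_toReal hRm.aemeasurable
        (ae_lt_top hRm ((hnum ε' hε').trans_lt ENNReal.one_lt_top).ne)]
      exact ENNReal.toReal_le_of_le_ofReal zero_le_one (by simpa using hnum ε' hε')
    have hlog : ∀ᵐ x ∂Q, 0 < (ε' x).toReal ∧ 0 < (ε x).toReal ∧
        Real.log (ε' x / ε x).toReal = Real.log (ε' x).toReal - Real.log (ε x).toReal := by
      filter_upwards [h0, htop, h0', htop'] with x h1 h2 h3 h4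
      have p1 := ENNReal.toReal_pos h1 h2
      have p2 := ENNReal.toReal_pos h3 h4
      exact ⟨p2, p1, by rw [ENNReal.toReal_div, Real.log_div p2.ne' p1.ne']⟩
    set D : X → ℝ := fun x =>
      (ε' x / ε x).toReal - 1 - (Real.log (ε' x).toReal - Real.log (ε x).toReal) with hD
    have hD0 : 0 ≤ᵐ[Q] D := by
      filter_upwards [hlog] with x ⟨h1, h2, h3⟩
      have : 0 < (ε' x / ε x).toReal := by rw [ENNReal.toReal_div]; positivity
      have := Real.log_le_sub_one_of_pos this
      simp only [hD, ← h3, Pi.zero_apply]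
      linarith
    have hDint : Integrable D Q :=
      (hRint.sub (integrable_const _)).sub (hint'.sub hint)
    have hDi : ∫ x, D x ∂Q = ∫ x, (ε' x / ε x).toReal ∂Q - 1 -
        (∫ x, Real.log (ε' x).toReal ∂Q - ∫ x, Real.log (ε x).toReal ∂Q) := by
      have h1 : ∫ x, D x ∂Q = ∫ x, ((ε' x / ε x).toReal - 1) ∂Q -
          ∫ x, (Real.log (ε' x).toReal - Real.log (ε x).toReal) ∂Q :=
        integral_sub (hRint.sub (integrable_const _)) (hint'.sub hint)
      rw [h1, integral_sub hRint (integrable_const _), integral_sub hint' hint]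
      simp
    have hDnn := integral_nonneg_of_ae hD0
    rw [hE, hE', EReal.coe_le_coe_iff, EReal.coe_le_coe_iff]
    refine ⟨by linarith, fun hle => ?_⟩
    have hz : ∫ x, D x ∂Q = 0 := le_antisymm (by linarith) hDnn
    filter_upwards [(integral_eq_zero_iff_of_nonneg_ae hD0 hDint).1 hz, hlog, htop, htop']
      with x hx ⟨h1, h2, h3⟩ h4 h5
    by_contra hne
    have hpos : 0 < (ε' x / ε x).toReal := by rw [ENNReal.toReal_div]; positivity
    have hne1 : (ε' x / ε x).toReal ≠ 1 := by
      rw [ENNReal.toReal_div]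
      intro h
      exact hne ((ENNReal.toReal_eq_toReal_iff' h5 h4).1 ((div_eq_one_iff_eq h2.ne').1 h))
    have := Real.log_lt_sub_one_of_pos hpos hne1
    simp only [hD, ← h3, Pi.zero_apply] at hx
    linarith
  have hbot : ∀ ε', IsEValue H ε' → ∫⁻ x, (-ENNReal.log (ε' x)).toENNReal ∂Q = ∞ →
      expectation Q (fun x => ENNReal.log (ε' x)) = ⊥ := by
    intro ε' hε' h
    rw [expectation, h]
    simp
  refine ⟨⟨hε, fun ε' hε' => ⟨Or.inl (hpos ε' hε'), ?_⟩⟩, fun ε' hε' => ?_⟩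
  · by_cases h : ∫⁻ x, (-ENNReal.log (ε' x)).toENNReal ∂Q = ∞
    · rw [hbot ε' hε' h]; exact bot_le
    · exact (key ε' hε' h).1
  · by_cases h : ∫⁻ x, (-ENNReal.log (ε' x)).toENNReal ∂Q = ∞
    · have := (hε'.2 ε hε).2
      rw [hbot ε' hε'.1 h, hE] at this
      exact absurd this (by simp)
    · exact (key ε' hε'.1 h).2 (hε'.2 ε hε).2

/-! ### Variation diminution -/

/-- Integrating a linear inequality against a weight. -/
lemma nonneg_of_ae_weighted {X : Type*} [MeasurableSpace X] {ν : Measure X} {γ r a b : X → ℝ}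
    (hr : Integrable (fun x => γ x * r x) ν) (ha : Integrable (fun x => γ x * a x) ν)
    (hb : Integrable (fun x => γ x * b x) ν) {k l m : ℝ}
    (h : ∀ᵐ z ∂ν, 0 ≤ γ z * (k * r z + l * a z + m * b z)) :
    0 ≤ k * ∫ z, γ z * r z ∂ν + l * ∫ z, γ z * a z ∂ν + m * ∫ z, γ z * b z ∂ν := by
  have hsum : ∫ z, (k * (γ z * r z) + l * (γ z * a z) + m * (γ z * b z)) ∂ν
      = k * ∫ z, γ z * r z ∂ν + l * ∫ z, γ z * a z ∂ν + m * ∫ z, γ z * b z ∂ν := by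
    have h1 : Integrable (fun z => k * (γ z * r z) + l * (γ z * a z)) ν :=
      (hr.const_mul k).add (ha.const_mul l)
    rw [integral_add h1 (hb.const_mul m), integral_add (hr.const_mul k) (ha.const_mul l),
      integral_const_mul, integral_const_mul, integral_const_mul]
  rw [← hsum]
  refine integral_nonneg_of_ae (h.mono fun z hz => ?_)
  simp only [Pi.zero_apply]
  linarith

/-- The determinant of the integrals of `r, a, b` against three weights is nonnegative when the
weighted third-order minors of `r, a, b` are: the determinant is linear in each column, so the
integrals can be taken one column at a time. -/
lemma det3_integral_nonneg {X : Type*} [MeasurableSpace X] {ν : Measure X}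
    {α β γ r a b : X → ℝ}
    (hα : ∀ g ∈ ({r, a, b} : Set (X → ℝ)), Integrable (fun x => α x * g x) ν)
    (hβ : ∀ g ∈ ({r, a, b} : Set (X → ℝ)), Integrable (fun x => β x * g x) ν)
    (hγ : ∀ g ∈ ({r, a, b} : Set (X → ℝ)), Integrable (fun x => γ x * g x) ν)
    (h : ∀ᵐ x ∂ν, ∀ᵐ y ∂ν, ∀ᵐ z ∂ν, 0 ≤ α x * β y * γ z *
      (r x * (a y * b z - a z * b y) - r y * (a x * b z - a z * b x)
        + r z * (a x * b y - a y * b x))) :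
    0 ≤ (∫ x, α x * r x ∂ν) *
          ((∫ y, β y * a y ∂ν) * (∫ z, γ z * b z ∂ν) - (∫ z, γ z * a z ∂ν) * ∫ y, β y * b y ∂ν)
        - (∫ y, β y * r y ∂ν) *
          ((∫ x, α x * a x ∂ν) * (∫ z, γ z * b z ∂ν) - (∫ z, γ z * a z ∂ν) * ∫ x, α x * b x ∂ν)
        + (∫ z, γ z * r z ∂ν) *
          ((∫ x, α x * a x ∂ν) * (∫ y, β y * b y ∂ν) - (∫ y, β y * a y ∂ν) * ∫ x, α x * b x ∂ν) := by
  simp only [Set.mem_insert_iff, Set.mem_singleton_iff, forall_eq_or_imp, forall_eq] at hα hβ hγ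
  obtain ⟨hαr, hαa, hαb⟩ := hα
  obtain ⟨hβr, hβa, hβb⟩ := hβ
  obtain ⟨hγr, hγa, hγb⟩ := hγ
  have h1 : ∀ᵐ x ∂ν, ∀ᵐ y ∂ν, 0 ≤ α x * β y *
      (r x * (a y * (∫ z, γ z * b z ∂ν) - (∫ z, γ z * a z ∂ν) * b y)
        - r y * (a x * (∫ z, γ z * b z ∂ν) - (∫ z, γ z * a z ∂ν) * b x)
        + (∫ z, γ z * r z ∂ν) * (a x * b y - a y * b x)) := by
    filter_upwards [h] with x hx
    filter_upwards [hx] with y hy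
    have := nonneg_of_ae_weighted hγr hγa hγb (k := α x * β y * (a x * b y - a y * b x))
      (l := α x * β y * (r y * b x - r x * b y)) (m := α x * β y * (r x * a y - r y * a x))
      (hy.mono fun z hz => by linarith)
    linarith
  have h2 : ∀ᵐ x ∂ν, 0 ≤ α x *
      (r x * ((∫ y, β y * a y ∂ν) * (∫ z, γ z * b z ∂ν)
          - (∫ z, γ z * a z ∂ν) * ∫ y, β y * b y ∂ν)
        - (∫ y, β y * r y ∂ν) * (a x * (∫ z, γ z * b z ∂ν) - (∫ z, γ z * a z ∂ν) * b x)
        + (∫ z, γ z * r z ∂ν) * (a x * (∫ y, β y * b y ∂ν) - (∫ y, β y * a y ∂ν) * b x)) := by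
    filter_upwards [h1] with x hx
    have := nonneg_of_ae_weighted hβr hβa hβb
      (k := - α x * (a x * (∫ z, γ z * b z ∂ν) - (∫ z, γ z * a z ∂ν) * b x))
      (l := α x * (r x * (∫ z, γ z * b z ∂ν) - (∫ z, γ z * r z ∂ν) * b x))
      (m := α x * ((∫ z, γ z * r z ∂ν) * a x - r x * ∫ z, γ z * a z ∂ν))
      (hx.mono fun y hy => by linarith)
    linarith
  have := nonneg_of_ae_weighted hαr hαa hαb
      (k := (∫ y, β y * a y ∂ν) * (∫ z, γ z * b z ∂ν) - (∫ z, γ z * a z ∂ν) * ∫ y, β y * b y ∂ν)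
      (l := (∫ z, γ z * r z ∂ν) * (∫ y, β y * b y ∂ν) - (∫ y, β y * r y ∂ν) * ∫ z, γ z * b z ∂ν)
      (m := (∫ y, β y * r y ∂ν) * (∫ z, γ z * a z ∂ν) - (∫ z, γ z * r z ∂ν) * ∫ y, β y * a y ∂ν)
      (h2.mono fun y hy => by linarith)
  linarith

lemma det2_integral_nonneg {X : Type*} [MeasurableSpace X] {ν : Measure X} {α γ a b : X → ℝ}
    (hαa : Integrable (fun x => α x * a x) ν) (hαb : Integrable (fun x => α x * b x) ν)
    (hγa : Integrable (fun x => γ x * a x) ν) (hγb : Integrable (fun x => γ x * b x) ν)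
    (h : ∀ᵐ x ∂ν, ∀ᵐ z ∂ν, 0 ≤ α x * γ z * (a x * b z - a z * b x)) :
    0 ≤ (∫ x, α x * a x ∂ν) * (∫ z, γ z * b z ∂ν) - (∫ z, γ z * a z ∂ν) * ∫ x, α x * b x ∂ν := by
  have h1 : ∀ᵐ x ∂ν, 0 ≤ α x * (a x * (∫ z, γ z * b z ∂ν) - (∫ z, γ z * a z ∂ν) * b x) := by
    filter_upwards [h] with x hx
    have := nonneg_of_ae_weighted hγa hγa hγb (k := 0) (l := - α x * b x) (m := α x * a x)
      (hx.mono fun z hz => by linarith)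
    linarith
  have := nonneg_of_ae_weighted hαa hαa hαb (k := 0) (l := ∫ z, γ z * b z ∂ν)
    (m := - ∫ z, γ z * a z ∂ν) (h1.mono fun z hz => by linarith)
  linarith

/-- If the minors are positive wherever both weights are, the determinant of the integrals
vanishes only when one of the weights vanishes. -/
lemma ae_eq_zero_of_det2_integral_eq_zero {X : Type*} [MeasurableSpace X] {ν : Measure X}
    {α γ a b : X → ℝ} (hα0 : ∀ x, 0 ≤ α x) (hγ0 : ∀ x, 0 ≤ γ x)
    (hαa : Integrable (fun x => α x * a x) ν) (hαb : Integrable (fun x => α x * b x) ν)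
    (hγa : Integrable (fun x => γ x * a x) ν) (hγb : Integrable (fun x => γ x * b x) ν)
    (h : ∀ᵐ x ∂ν, ∀ᵐ z ∂ν, 0 < α x → 0 < γ z → 0 < a x * b z - a z * b x)
    (h0 : (∫ x, α x * a x ∂ν) * (∫ z, γ z * b z ∂ν)
      - (∫ z, γ z * a z ∂ν) * ∫ x, α x * b x ∂ν = 0) :
    α =ᵐ[ν] 0 ∨ γ =ᵐ[ν] 0 := by
  have hw : ∀ᵐ x ∂ν, ∀ᵐ z ∂ν, 0 ≤ α x * γ z * (a x * b z - a z * b x) := by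
    filter_upwards [h] with x hx
    filter_upwards [hx] with z hz
    rcases (hα0 x).eq_or_lt with hx0 | hx0
    · simp [← hx0]
    rcases (hγ0 z).eq_or_lt with hz0 | hz0
    · simp [← hz0]
    exact (mul_pos (mul_pos hx0 hz0) (hz hx0 hz0)).le
  have hinner : ∀ x, ∫ z, α x * γ z * (a x * b z - a z * b x) ∂ν =
      α x * (a x * (∫ z, γ z * b z ∂ν) - (∫ z, γ z * a z ∂ν) * b x) := by
    intro x
    rw [← integral_const_mul, ← integral_mul_const,
      ← integral_sub (hγb.const_mul _) (hγa.mul_const _), ← integral_const_mul]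
    exact integral_congr_ae (.of_forall fun z => by dsimp only; ring)
  have houter : ∫ x, α x * (a x * (∫ z, γ z * b z ∂ν) - (∫ z, γ z * a z ∂ν) * b x) ∂ν = 0 := by
    have hexp : ∀ x, α x * (a x * (∫ z, γ z * b z ∂ν) - (∫ z, γ z * a z ∂ν) * b x) =
        α x * a x * (∫ z, γ z * b z ∂ν) - (∫ z, γ z * a z ∂ν) * (α x * b x) := fun x => by ring
    simp_rw [hexp]
    rw [integral_sub (hαa.mul_const _) (hαb.const_mul _), integral_mul_const, integral_const_mul,
      h0]
  have houtI : Integrable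
      (fun x => α x * (a x * (∫ z, γ z * b z ∂ν) - (∫ z, γ z * a z ∂ν) * b x)) ν :=
    ((hαa.mul_const (∫ z, γ z * b z ∂ν)).sub (hαb.const_mul (∫ z, γ z * a z ∂ν))).congr
      (.of_forall fun z => by simp only [Pi.sub_apply]; ring)
  have hz := (integral_eq_zero_iff_of_nonneg_ae
    (hw.mono fun x hx => by rw [Pi.zero_apply, ← hinner x]; exact integral_nonneg_of_ae hx)
    houtI).1 houter
  rw [or_iff_not_imp_left]
  intro hα
  have hfreq : ∃ᵐ x ∂ν, α x ≠ 0 := fun hn => hα (hn.mono fun x hx => not_not.1 hx)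
  obtain ⟨x, hαx, hx, hwx, hzx⟩ := (hfreq.and_eventually (h.and (hw.and hz))).exists
  replace hzx := (hinner x).trans hzx
  have hI : Integrable (fun z => α x * γ z * (a x * b z - a z * b x)) ν :=
    (((hγb.const_mul (a x)).sub (hγa.mul_const (b x))).const_mul (α x)).congr
      (.of_forall fun z => by simp only [Pi.sub_apply]; ring)
  filter_upwards [(integral_eq_zero_iff_of_nonneg_ae hwx hI).1 hzx, hx] with z hz0 hz
  have hαx' : 0 < α x := (hα0 x).lt_of_ne' hαx
  by_contra hγz
  have hγz' : 0 < γ z := (hγ0 z).lt_of_ne' hγz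
  exact (mul_pos (mul_pos hαx' hγz') (hz hαx' hγz')).ne' hz0

/-- Two nonnegative weights, the first to the left of the second, cannot have the same
integrals against `a` and `b` unless both vanish. -/
lemma ae_eq_zero_of_integral_eq {X : Type*} [MeasurableSpace X] {ν : Measure X}
    {α γ a b : X → ℝ} (hα0 : ∀ x, 0 ≤ α x) (hγ0 : ∀ x, 0 ≤ γ x) (ha0 : ∀ x, 0 < a x)
    (hαa : Integrable (fun x => α x * a x) ν) (hαb : Integrable (fun x => α x * b x) ν)
    (hγa : Integrable (fun x => γ x * a x) ν) (hγb : Integrable (fun x => γ x * b x) ν)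
    (h : ∀ᵐ x ∂ν, ∀ᵐ z ∂ν, 0 < α x → 0 < γ z → 0 < a x * b z - a z * b x)
    (hEa : ∫ x, α x * a x ∂ν = ∫ x, γ x * a x ∂ν) (hEb : ∫ x, α x * b x ∂ν = ∫ x, γ x * b x ∂ν) :
    α =ᵐ[ν] 0 ∧ γ =ᵐ[ν] 0 := by
  have hzero : ∀ δ : X → ℝ, (∀ x, 0 ≤ δ x) → Integrable (fun x => δ x * a x) ν →
      ∫ x, δ x * a x ∂ν = 0 → δ =ᵐ[ν] 0 := by
    intro δ hδ hi h0
    filter_upwards [(integral_eq_zero_iff_of_nonneg (fun x => mul_nonneg (hδ x) (ha0 x).le) hi).1 h0]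
      with x hx
    exact (mul_eq_zero.1 hx).resolve_right (ha0 x).ne'
  have hint0 : ∀ δ : X → ℝ, δ =ᵐ[ν] 0 → ∫ x, δ x * a x ∂ν = 0 := fun δ hδ =>
    integral_eq_zero_of_ae (hδ.mono fun x hx => by simp [hx])
  rcases ae_eq_zero_of_det2_integral_eq_zero hα0 hγ0 hαa hαb hγa hγb h
    (by rw [hEa, hEb]; ring) with h' | h'
  · exact ⟨h', hzero γ hγ0 hγa (hEa ▸ hint0 α h')⟩
  · exact ⟨hzero α hα0 hαa (hEa.trans (hint0 γ h')), h'⟩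

/-- Variation diminution: let `f` be orthogonal to `a` and `b` and let `{f > 0}` be order-convex,
so that `f` has sign pattern `-, +, -`. Then `∫ f r ≤ 0` for every `r` whose third-order minors
with `a, b` are nonnegative. With `α, β, γ` the absolute values of `f` on its three sign regions,
the determinant of the integrals of `r, a, b` against `α, β, γ` is nonnegative, and column
operations turn it into `-∫ f r` times the minor of `a, b` against `α, γ`. If that minor vanishes,
so does `f`. -/
theorem integral_mul_nonpos_of_sign_pattern {X : Type*} [LinearOrder X] [MeasurableSpace X]
    (hIio : ∀ x : X, MeasurableSet (Set.Iio x)) (hIoi : ∀ x : X, MeasurableSet (Set.Ioi x))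
    {ν : Measure X} {f r a b : X → ℝ} {S : Set X} (hS : ∀ᵐ x ∂ν, x ∈ S)
    (hr : Measurable r) (ha : Measurable a) (hb : Measurable b) (ha0 : ∀ x, 0 < a x)
    (hfr : Integrable (fun x => f x * r x) ν) (hfa : Integrable (fun x => f x * a x) ν)
    (hfb : Integrable (fun x => f x * b x) ν) (hf : Measurable f)
    (hEa : ∫ x, f x * a x ∂ν = 0) (hEb : ∫ x, f x * b x ∂ν = 0)
    (hpat : ∀ x ∈ S, ∀ y ∈ S, ∀ z ∈ S, x < y → y < z → 0 < f x → 0 < f z → 0 < f y)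
    (hD2 : ∀ x z, x < z → 0 < a x * b z - a z * b x)
    (hD3 : ∀ x y z, x < y → y < z → 0 ≤ r x * (a y * b z - a z * b y)
      - r y * (a x * b z - a z * b x) + r z * (a x * b y - a y * b x)) :
    ∫ x, f x * r x ∂ν ≤ 0 := by
  by_cases hex : ∃ x₀ ∈ S, 0 < f x₀
  swap
  · push Not at hex
    have hneg : 0 ≤ᵐ[ν] fun x => -(f x * a x) := hS.mono fun x hx => by
      have := mul_nonneg (neg_nonneg.2 (hex x hx)) (ha0 x).le
      simpa using this
    have := (integral_eq_zero_iff_of_nonneg_ae hneg hfa.neg).1 (by rw [integral_neg, hEa, neg_zero])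
    refine (integral_eq_zero_of_ae (this.mono fun x hx => ?_)).le
    have : f x = 0 := by simpa [(ha0 x).ne'] using hx
    simp [this]
  obtain ⟨x₀, hx₀S, hx₀⟩ := hex
  set α : X → ℝ := fun x => if x < x₀ then max (-f x) 0 else 0 with hα
  set β : X → ℝ := fun x => max (f x) 0 with hβ
  set γ : X → ℝ := fun x => if x₀ < x then max (-f x) 0 else 0 with hγ
  have hα0 : ∀ x, 0 ≤ α x := fun x => by simp only [hα]; split_ifs <;> simp
  have hβ0 : ∀ x, 0 ≤ β x := fun x => by simp [hβ]
  have hγ0 : ∀ x, 0 ≤ γ x := fun x => by simp only [hγ]; split_ifs <;> simp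
  have hdec : ∀ x, f x = β x - α x - γ x := by
    intro x
    simp only [hα, hβ, hγ]
    rcases lt_trichotomy x x₀ with h | rfl | h
    · rw [if_pos h, if_neg h.not_gt]
      rcases le_total (f x) 0 with h' | h' <;> simp [h']
    · simp [hx₀.le]
    · rw [if_pos h, if_neg h.not_gt]
      rcases le_total (f x) 0 with h' | h' <;> simp [h']
  have hαpos : ∀ x, 0 < α x → x < x₀ ∧ f x < 0 := by
    intro x
    simp only [hα]
    split_ifs with h <;> simp [h]
  have hγpos : ∀ x, 0 < γ x → x₀ < x ∧ f x < 0 := by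
    intro x
    simp only [hγ]
    split_ifs with h <;> simp [h]
  have hβpos : ∀ x, 0 < β x → 0 < f x := by
    intro x
    simp [hβ]
  have hαβ : ∀ x ∈ S, ∀ y ∈ S, 0 < α x → 0 < β y → x < y := by
    intro x hx y hy h1 h2
    obtain ⟨h3, h4⟩ := hαpos x h1
    have h5 := hβpos y h2
    by_contra hlt
    rcases (not_lt.1 hlt).eq_or_lt with h | h
    · subst h; linarith
    · linarith [hpat y hy x hx x₀ hx₀S h h3 h5 hx₀]
  have hβγ : ∀ x ∈ S, ∀ y ∈ S, 0 < β x → 0 < γ y → x < y := by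
    intro x hx y hy h1 h2
    obtain ⟨h3, h4⟩ := hγpos y h2
    have h5 := hβpos x h1
    by_contra hlt
    rcases (not_lt.1 hlt).eq_or_lt with h | h
    · subst h; linarith
    · linarith [hpat x₀ hx₀S y hy x hx h3 h hx₀ h5]
  have hαm : Measurable α := Measurable.ite (hIio x₀) (by fun_prop) measurable_const
  have hβm : Measurable β := by fun_prop
  have hγm : Measurable γ := Measurable.ite (hIoi x₀) (by fun_prop) measurable_const
  have habs : ∀ x, |f x| = α x + β x + γ x := by
    intro x
    simp only [hα, hβ, hγ]
    rcases lt_trichotomy x x₀ with h | rfl | h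
    · rw [if_pos h, if_neg h.not_gt]
      rcases le_total (f x) 0 with h' | h' <;> simp [h', abs_of_nonneg, abs_of_nonpos]
    · simp [hx₀.le, abs_of_nonneg]
    · rw [if_pos h, if_neg h.not_gt]
      rcases le_total (f x) 0 with h' | h' <;> simp [h', abs_of_nonneg, abs_of_nonpos]
  have hint : ∀ g δ : X → ℝ, Measurable g → Integrable (fun x => f x * g x) ν → Measurable δ →
      (∀ x, 0 ≤ δ x) → (∀ x, δ x ≤ |f x|) → Integrable (fun x => δ x * g x) ν := by
    intro g δ hg hfg hδ hδ0 hδf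
    refine hfg.mono (hδ.mul hg).aestronglyMeasurable (.of_forall fun x => ?_)
    rw [norm_mul, norm_mul, Real.norm_of_nonneg (hδ0 x)]
    exact mul_le_mul_of_nonneg_right (hδf x) (norm_nonneg _)
  have hαf : ∀ x, α x ≤ |f x| := fun x => by linarith [habs x, hβ0 x, hγ0 x]
  have hβf : ∀ x, β x ≤ |f x| := fun x => by linarith [habs x, hα0 x, hγ0 x]
  have hγf : ∀ x, γ x ≤ |f x| := fun x => by linarith [habs x, hα0 x, hβ0 x]
  have hsplit : ∀ g : X → ℝ, Measurable g → Integrable (fun x => f x * g x) ν →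
      ∫ x, f x * g x ∂ν = ∫ x, β x * g x ∂ν - ∫ x, α x * g x ∂ν - ∫ x, γ x * g x ∂ν := by
    intro g hg hfg
    have hA := hint g α hg hfg hαm hα0 hαf
    have hB := hint g β hg hfg hβm hβ0 hβf
    have hC := hint g γ hg hfg hγm hγ0 hγf
    have hBA : Integrable (fun x => β x * g x - α x * g x) ν := hB.sub hA
    rw [← integral_sub hB hA, ← integral_sub hBA hC]
    exact integral_congr_ae (.of_forall fun x => by dsimp only; rw [hdec x]; ring)
  rw [hsplit a ha hfa] at hEa
  rw [hsplit b hb hfb] at hEb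
  have hαa := hint a α ha hfa hαm hα0 hαf
  have hαb := hint b α hb hfb hαm hα0 hαf
  have hαr := hint r α hr hfr hαm hα0 hαf
  have hβa := hint a β ha hfa hβm hβ0 hβf
  have hβb := hint b β hb hfb hβm hβ0 hβf
  have hβr := hint r β hr hfr hβm hβ0 hβf
  have hγa := hint a γ ha hfa hγm hγ0 hγf
  have hγb := hint b γ hb hfb hγm hγ0 hγf
  have hγr := hint r γ hr hfr hγm hγ0 hγf
  have h3 := det3_integral_nonneg (ν := ν) (α := α) (β := β) (γ := γ) (r := r) (a := a) (b := b)
    (by simp [hαa, hαb, hαr]) (by simp [hβa, hβb, hβr]) (by simp [hγa, hγb, hγr]) (by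
      filter_upwards [hS] with x hx
      filter_upwards [hS] with y hy
      filter_upwards [hS] with z hz
      rcases (hα0 x).eq_or_lt with hx0 | hx0
      · simp [← hx0]
      rcases (hβ0 y).eq_or_lt with hy0 | hy0
      · simp [← hy0]
      rcases (hγ0 z).eq_or_lt with hz0 | hz0
      · simp [← hz0]
      exact mul_nonneg (by positivity) (hD3 x y z (hαβ x hx y hy hx0 hy0) (hβγ y hy z hz hy0 hz0)))
  have hαγ : ∀ᵐ x ∂ν, ∀ᵐ z ∂ν, 0 < α x → 0 < γ z → 0 < a x * b z - a z * b x :=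
    .of_forall fun x => .of_forall fun z h1 h2 =>
      hD2 x z ((hαpos x h1).1.trans (hγpos z h2).1)
  have h2 := det2_integral_nonneg hαa hαb hγa hγb (by
    filter_upwards [hαγ] with x hx
    filter_upwards [hx] with z hz
    rcases (hα0 x).eq_or_lt with hx0 | hx0
    · simp [← hx0]
    rcases (hγ0 z).eq_or_lt with hz0 | hz0
    · simp [← hz0]
    exact mul_nonneg (by positivity) (hz hx0 hz0).le)
  have hzero : ∀ (δ g : X → ℝ), δ =ᵐ[ν] 0 → ∫ x, δ x * g x ∂ν = 0 := fun δ g hδ =>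
    integral_eq_zero_of_ae (hδ.mono fun x hx => by simp [hx])
  rw [hsplit r hr hfr]
  rcases h2.eq_or_lt with h2 | h2
  · rcases ae_eq_zero_of_det2_integral_eq_zero hα0 hγ0 hαa hαb hγa hγb hαγ h2.symm with h | h
    · obtain ⟨h5, h6⟩ := ae_eq_zero_of_integral_eq hβ0 hγ0 ha0 hβa hβb hγa hγb
        (by
          filter_upwards [hS] with x hx
          filter_upwards [hS] with z hz h7 h8
          exact hD2 x z (hβγ x hx z hz h7 h8))
        (by linarith [hzero α a h]) (by linarith [hzero α b h])
      simp [hzero α r h, hzero β r h5, hzero γ r h6]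
    · obtain ⟨h5, h6⟩ := ae_eq_zero_of_integral_eq hα0 hβ0 ha0 hαa hαb hβa hβb
        (by
          filter_upwards [hS] with x hx
          filter_upwards [hS] with z hz h7 h8
          exact hD2 x z (hαβ x hx z hz h7 h8))
        (by linarith [hzero γ a h]) (by linarith [hzero γ b h])
      simp [hzero γ r h, hzero α r h5, hzero β r h6]
  · -- Subtracting the outer columns from the middle one leaves `(∫ f r, 0, 0)`.
    rw [show ∫ x, β x * a x ∂ν = ∫ x, α x * a x ∂ν + ∫ x, γ x * a x ∂ν by linarith,
      show ∫ x, β x * b x ∂ν = ∫ x, α x * b x ∂ν + ∫ x, γ x * b x ∂ν by linarith] at h3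
    by_contra! hlt
    have := mul_pos hlt h2
    linarith

/-! ### Calibration of the mixture weight -/

/-- The equality case of Chebyshev's association inequality `E[r s] ≥ E[r] E[s]`, for strictly
similarly ordered `r` and `s` of mean one: then the law is concentrated at a point. -/
lemma ae_eq_one_of_integral_mul_le {X : Type*} [MeasurableSpace X] {π : Measure X}
    [IsProbabilityMeasure π] {r s : X → ℝ} {S : Set X} (hS : ∀ᵐ x ∂π, x ∈ S)
    (hr : Integrable r π) (hs : Integrable s π) (hrs : Integrable (fun x => r x * s x) π)
    (hr1 : ∫ x, r x ∂π = 1) (hs1 : ∫ x, s x ∂π = 1) (hle : ∫ x, r x * s x ∂π ≤ 1)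
    (hord : ∀ x ∈ S, ∀ y ∈ S, x ≠ y → 0 < (r x - r y) * (s x - s y)) :
    ∀ᵐ x ∂π, r x = 1 := by
  have hord' : ∀ x ∈ S, ∀ y ∈ S, 0 ≤ (r x - r y) * (s x - s y) := by
    intro x hx y hy
    by_cases h : x = y
    · simp [h]
    · exact (hord x hx y hy h).le
  have hI : ∀ y, Integrable (fun x => (r x - r y) * (s x - s y)) π := fun y =>
    (((hrs.sub (hr.mul_const (s y))).sub (hs.const_mul (r y))).add
      (integrable_const (r y * s y))).congr
      (.of_forall fun x => by simp only [Pi.add_apply, Pi.sub_apply]; ring)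
  have hinner : ∀ y, ∫ x, (r x - r y) * (s x - s y) ∂π =
      ∫ x, r x * s x ∂π - s y - r y + r y * s y := by
    intro y
    have h1 : Integrable (fun x => r x * s x - r x * s y) π := hrs.sub (hr.mul_const (s y))
    have h2 : Integrable (fun x => r x * s x - r x * s y - r y * s x) π :=
      h1.sub (hs.const_mul (r y))
    have : ∀ x, (r x - r y) * (s x - s y) = r x * s x - r x * s y - r y * s x + r y * s y :=
      fun x => by ring
    simp_rw [this]
    rw [integral_add h2 (integrable_const _), integral_sub h1 (hs.const_mul _),
      integral_sub hrs (hr.mul_const _), integral_mul_const, integral_const_mul, hr1, hs1]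
    simp
  set g : X → ℝ := fun y => ∫ x, r x * s x ∂π - s y - r y + r y * s y with hg
  have hg0 : 0 ≤ᵐ[π] g := by
    filter_upwards [hS] with y hy
    exact (integral_nonneg_of_ae (hS.mono fun x hx => hord' x hx y hy)).trans_eq (hinner y)
  have h1 : Integrable (fun y => ∫ x, r x * s x ∂π - s y) π := (integrable_const _).sub hs
  have h2 : Integrable (fun y => ∫ x, r x * s x ∂π - s y - r y) π := h1.sub hr
  have hgI : Integrable g π := h2.add hrs
  have hgi : ∫ y, g y ∂π = 2 * (∫ x, r x * s x ∂π - 1) := by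
    rw [hg, integral_add h2 hrs, integral_sub h1 hr, integral_sub (integrable_const _) hs, hr1, hs1]
    simp
    ring
  have hg00 := (integral_eq_zero_iff_of_nonneg_ae hg0 hgI).1
    (le_antisymm (by linarith) (integral_nonneg_of_ae hg0))
  obtain ⟨y, hy, hyS⟩ := (hg00.and hS).exists
  have hxy : ∀ᵐ x ∂π, x = y := by
    filter_upwards [hS, (integral_eq_zero_iff_of_nonneg_ae
      (hS.mono fun x hx => hord' x hx y hyS) (hI y)).1 ((hinner y).trans hy)] with x hx h0
    by_contra hne
    exact (hord x hx y hyS hne).ne' h0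
  have hry : r y = 1 := by
    rw [← hr1, integral_congr_ae (hxy.mono fun x (hx : x = y) => by rw [hx] : r =ᵐ[π] fun _ => r y)]
    simp
  exact hxy.mono fun x hx => by rw [hx, hry]

lemma mixture_pos {u v c : ℝ} (hu : 0 < u) (hv : 0 < v) (hc : c ∈ Set.Ioo (0 : ℝ) 1) :
    0 < c * u + (1 - c) * v := by
  have := hc.1
  have : 0 < 1 - c := sub_pos.2 hc.2
  positivity

lemma mul_div_mixture_le {q u v c : ℝ} (hq : 0 ≤ q) (hu : 0 < u) (hv : 0 < v)
    (hc : c ∈ Set.Ioo (0 : ℝ) 1) : q * u / (c * u + (1 - c) * v) ≤ q / c := by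
  have h0 := hc.1
  have h1 : 0 < 1 - c := sub_pos.2 hc.2
  rw [div_le_div_iff₀ (mixture_pos hu hv hc) h0]
  nlinarith [mul_nonneg hq (mul_pos h1 hv).le]

lemma integrable_mul_div_mixture {X : Type*} [MeasurableSpace X] {ν : Measure X} {a b q : X → ℝ}
    (ha : Measurable a) (hb : Measurable b) (hq : Integrable q ν) (ha0 : ∀ x, 0 < a x)
    (hb0 : ∀ x, 0 < b x) (hq0 : ∀ x, 0 ≤ q x) {c : ℝ} (hc : c ∈ Set.Ioo (0 : ℝ) 1) :
    Integrable (fun x => q x * a x / (c * a x + (1 - c) * b x)) ν := by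
  refine (hq.div_const c).mono ?_ (.of_forall fun x => ?_)
  · have : Measurable fun x => a x / (c * a x + (1 - c) * b x) := by fun_prop
    exact (hq.aestronglyMeasurable.mul this.aestronglyMeasurable).congr
      (.of_forall fun x => by simp only [Pi.mul_apply]; ring)
  · have h1 := mixture_pos (ha0 x) (hb0 x) hc
    have := hc.1
    rw [Real.norm_of_nonneg (by have := hq0 x; have := ha0 x; positivity),
      Real.norm_of_nonneg (by have := hq0 x; positivity)]
    exact mul_div_mixture_le (hq0 x) (ha0 x) (hb0 x) hc

lemma continuousOn_integral_mul_div_mixture {X : Type*} [MeasurableSpace X] {ν : Measure X}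
    {a b q : X → ℝ} (ha : Measurable a) (hb : Measurable b) (hq : Integrable q ν)
    (ha0 : ∀ x, 0 < a x) (hb0 : ∀ x, 0 < b x) (hq0 : ∀ x, 0 ≤ q x) :
    ContinuousOn (fun c : ℝ => ∫ x, q x * a x / (c * a x + (1 - c) * b x) ∂ν) (Set.Ioo 0 1) := by
  intro c hc
  refine ContinuousAt.continuousWithinAt ?_
  have hn : Set.Ioo (c / 2) 1 ∈ nhds c := Ioo_mem_nhds (by linarith [hc.1]) hc.2
  have hsub : ∀ d ∈ Set.Ioo (c / 2) 1, d ∈ Set.Ioo (0 : ℝ) 1 := fun d hd =>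
    ⟨by linarith [hd.1, hc.1], hd.2⟩
  refine continuousAt_of_dominated (bound := fun x => q x / (c / 2)) ?_ ?_ (hq.div_const _) ?_
  · filter_upwards [hn] with d hd
    exact (integrable_mul_div_mixture ha hb hq ha0 hb0 hq0 (hsub d hd)).aestronglyMeasurable
  · filter_upwards [hn] with d hd
    refine .of_forall fun x => ?_
    have h1 := mixture_pos (ha0 x) (hb0 x) (hsub d hd)
    rw [Real.norm_of_nonneg (by have := hq0 x; have := ha0 x; positivity)]
    refine (mul_div_mixture_le (hq0 x) (ha0 x) (hb0 x) (hsub d hd)).trans ?_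
    exact div_le_div_of_nonneg_left (hq0 x) (by linarith [hc.1]) hd.1.le
  · refine .of_forall fun x => ?_
    refine ContinuousAt.div (by fun_prop) (by fun_prop) (mixture_pos (ha0 x) (hb0 x) hc).ne'

/-- If the expectation of the likelihood ratio under the second component were below one for every
`c`, then letting `c → 1` Fatou's lemma would give `∫ q b / a ≤ 1`. As `b / a` and `q / a` are
strictly similarly ordered, Chebyshev's inequality then forces `a = b` almost everywhere, and the
expectation is one after all. -/
lemma exists_one_le_integral_mul_div_mixture {X : Type*} [MeasurableSpace X] {ν : Measure X}
    {a b q : X → ℝ} {S : Set X} (hS : ∀ᵐ x ∂ν, x ∈ S)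
    (ha : Measurable a) (hb : Measurable b) (hqm : Measurable q)
    (ha0 : ∀ x, 0 < a x) (hb0 : ∀ x, 0 < b x) (hq0 : ∀ x, 0 ≤ q x)
    (haI : Integrable a ν) (hbI : Integrable b ν) (hqI : Integrable q ν)
    (ha1 : ∫ x, a x ∂ν = 1) (hb1 : ∫ x, b x ∂ν = 1) (hq1 : ∫ x, q x ∂ν = 1)
    (hord : ∀ x ∈ S, ∀ y ∈ S, x ≠ y → 0 < (b x / a x - b y / a y) * (q x / a x - q y / a y)) :
    ∃ c ∈ Set.Ioo (0 : ℝ) 1, 1 ≤ ∫ x, q x * b x / (c * a x + (1 - c) * b x) ∂ν := by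
  by_contra! hlt
  have hinv : ∀ c ∈ Set.Ioo (0 : ℝ) 1,
      Integrable (fun x => q x * b x / (c * a x + (1 - c) * b x)) ν := by
    intro c hc
    have := integrable_mul_div_mixture hb ha hqI hb0 ha0 hq0 (c := 1 - c)
      ⟨by linarith [hc.2], by linarith [hc.1]⟩
    refine this.congr (.of_forall fun x => ?_)
    dsimp only
    ring_nf
  -- Fatou's lemma along `c → 1`.
  have hfatou : ∫⁻ x, ENNReal.ofReal (q x * b x / a x) ∂ν ≤ 1 := by
    set c : ℕ → ℝ := fun n => 1 - 1 / ((n : ℝ) + 2) with hc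
    have hcI : ∀ n, c n ∈ Set.Ioo (0 : ℝ) 1 := by
      intro n
      have h1 : (0 : ℝ) < n + 2 := by positivity
      refine ⟨sub_pos.2 ((div_lt_one h1).2 (by linarith [n.cast_nonneg (α := ℝ)])), ?_⟩
      exact sub_lt_self _ (by positivity)
    have hclim : Filter.Tendsto c Filter.atTop (nhds 1) := by
      have h := (tendsto_one_div_add_atTop_nhds_zero_nat (𝕜 := ℝ)).comp (Filter.tendsto_add_atTop_nat 1)
      have h2 := h.const_sub 1
      rw [sub_zero] at h2
      refine h2.congr fun n => ?_
      simp only [hc, Function.comp]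
      push_cast
      ring
    have hlim : ∀ x, Filter.Tendsto
        (fun n => ENNReal.ofReal (q x * b x / (c n * a x + (1 - c n) * b x))) Filter.atTop
        (nhds (ENNReal.ofReal (q x * b x / a x))) := by
      intro x
      refine ENNReal.tendsto_ofReal (Filter.Tendsto.div tendsto_const_nhds ?_ (ha0 x).ne')
      have := (hclim.mul_const (a x)).add ((hclim.const_sub 1).mul_const (b x))
      simpa using this
    calc ∫⁻ x, ENNReal.ofReal (q x * b x / a x) ∂ν
        = ∫⁻ x, Filter.liminf
            (fun n => ENNReal.ofReal (q x * b x / (c n * a x + (1 - c n) * b x)))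
              Filter.atTop ∂ν := by
          simp_rw [fun x => (hlim x).liminf_eq]
      _ ≤ Filter.liminf (fun n => ∫⁻ x,
            ENNReal.ofReal (q x * b x / (c n * a x + (1 - c n) * b x)) ∂ν) Filter.atTop :=
          lintegral_liminf_le fun n => by fun_prop
      _ ≤ Filter.liminf (fun _ : ℕ => (1 : ℝ≥0∞)) Filter.atTop := by
          refine Filter.liminf_le_liminf (.of_forall fun n => ?_)
          rw [← ofReal_integral_eq_lintegral_ofReal (hinv _ (hcI n)) (.of_forall fun x => ?_)]
          · exact ENNReal.ofReal_le_one.2 (hlt _ (hcI n)).le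
          · have := mixture_pos (ha0 x) (hb0 x) (hcI n)
            have := hq0 x
            have := hb0 x
            simp only [Pi.zero_apply]
            positivity
      _ = 1 := Filter.liminf_const 1
  have hnn : ∀ x, 0 ≤ q x * b x / a x := fun x => by
    have := hq0 x
    have := hb0 x
    have := ha0 x
    positivity
  have hqbI : Integrable (fun x => q x * b x / a x) ν := by
    refine ⟨((hqm.mul hb).div ha).aestronglyMeasurable, ?_⟩
    rw [hasFiniteIntegral_iff_ofReal (.of_forall hnn)]
    exact hfatou.trans_lt ENNReal.one_lt_top
  have hqb1 : ∫ x, q x * b x / a x ∂ν ≤ 1 := by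
    rw [integral_eq_lintegral_of_nonneg_ae (.of_forall hnn) hqbI.aestronglyMeasurable]
    exact ENNReal.toReal_le_of_le_ofReal zero_le_one (by simpa using hfatou)
  -- Pass to the probability measure with density `a`.
  set π : Measure X := ν.withDensity fun x => ENNReal.ofReal (a x) with hπ
  have hπP : IsProbabilityMeasure π := ⟨by
    rw [hπ, withDensity_apply _ .univ, Measure.restrict_univ,
      ← ofReal_integral_eq_lintegral_ofReal haI (.of_forall fun x => (ha0 x).le), ha1,
      ENNReal.ofReal_one]⟩
  have hπν : ∀ g : X → ℝ, (∫ x, g x ∂π = ∫ x, a x * g x ∂ν) ∧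
      (Integrable g π ↔ Integrable (fun x => a x * g x) ν) := by
    intro g
    constructor
    · rw [hπ, integral_withDensity_eq_integral_toReal_smul (by fun_prop) (by simp)]
      simp [ENNReal.toReal_ofReal (ha0 _).le]
    · rw [hπ, integrable_withDensity_iff_integrable_smul' (by fun_prop) (by simp)]
      simp [ENNReal.toReal_ofReal (ha0 _).le]
  have e1 : (fun x => a x * (b x / a x)) = b := by
    funext x; have := (ha0 x).ne'; field_simp
  have e2 : (fun x => a x * (q x / a x)) = q := by
    funext x; have := (ha0 x).ne'; field_simp
  have e3 : (fun x => a x * (b x / a x * (q x / a x))) = fun x => q x * b x / a x := by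
    funext x; have := (ha0 x).ne'; field_simp
  have hae := ae_eq_one_of_integral_mul_le (π := π) (r := fun x => b x / a x)
    (s := fun x => q x / a x) (withDensity_absolutelyContinuous ν _ hS)
    ((hπν _).2.2 (by rw [e1]; exact hbI)) ((hπν _).2.2 (by rw [e2]; exact hqI))
    ((hπν _).2.2 (by rw [e3]; exact hqbI)) (by rw [(hπν _).1, e1, hb1])
    (by rw [(hπν _).1, e2, hq1]) (by rw [(hπν _).1, e3]; exact hqb1) hord
  have hae' : ∀ᵐ x ∂ν, b x = a x := by
    rw [hπ, ae_withDensity_iff (by fun_prop)] at hae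
    filter_upwards [hae] with x hx
    have := hx (by simpa using ha0 x)
    rwa [div_eq_one_iff_eq (ha0 x).ne'] at this
  have h12 : (1 / 2 : ℝ) ∈ Set.Ioo (0 : ℝ) 1 := by norm_num
  refine (hlt _ h12).ne ?_
  refine (integral_congr_ae (hae'.mono fun x hx => ?_)).trans hq1
  have := (ha0 x).ne'
  rw [hx]
  field_simp
  ring

/-- A calibrating mixture weight exists. The two expectations, weighted by `c` and `1 - c`, add up
to one, so it is enough that the first one takes the value one, and the intermediate value theorem
applies because neither expectation stays below one. -/
theorem exists_integral_mul_div_mixture_eq_one {X : Type*} [MeasurableSpace X] {ν : Measure X}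
    {a b q : X → ℝ} {S : Set X} (hS : ∀ᵐ x ∂ν, x ∈ S)
    (ha : Measurable a) (hb : Measurable b) (hqm : Measurable q)
    (ha0 : ∀ x, 0 < a x) (hb0 : ∀ x, 0 < b x) (hq0 : ∀ x, 0 ≤ q x)
    (haI : Integrable a ν) (hbI : Integrable b ν) (hqI : Integrable q ν)
    (ha1 : ∫ x, a x ∂ν = 1) (hb1 : ∫ x, b x ∂ν = 1) (hq1 : ∫ x, q x ∂ν = 1)
    (hord : ∀ x ∈ S, ∀ y ∈ S, x ≠ y → 0 < (b x / a x - b y / a y) * (q x / a x - q y / a y))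
    (hord' : ∀ x ∈ S, ∀ y ∈ S, x ≠ y → 0 < (a x / b x - a y / b y) * (q x / b x - q y / b y)) :
    ∃ c ∈ Set.Ioo (0 : ℝ) 1, ∫ x, q x * a x / (c * a x + (1 - c) * b x) ∂ν = 1 ∧
      ∫ x, q x * b x / (c * a x + (1 - c) * b x) ∂ν = 1 := by
  have hmem : ∀ c ∈ Set.Ioo (0 : ℝ) 1, 1 - c ∈ Set.Ioo (0 : ℝ) 1 := fun c hc =>
    ⟨by linarith [hc.2], by linarith [hc.1]⟩
  have hsum : ∀ c ∈ Set.Ioo (0 : ℝ) 1, c * ∫ x, q x * a x / (c * a x + (1 - c) * b x) ∂ν +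
      (1 - c) * ∫ x, q x * b x / (c * a x + (1 - c) * b x) ∂ν = 1 := by
    intro c hc
    have h1 := integrable_mul_div_mixture ha hb hqI ha0 hb0 hq0 hc
    have h2 : Integrable (fun x => q x * b x / (c * a x + (1 - c) * b x)) ν := by
      refine (integrable_mul_div_mixture hb ha hqI hb0 ha0 hq0 (hmem c hc)).congr
        (.of_forall fun x => ?_)
      dsimp only
      ring_nf
    rw [← integral_const_mul, ← integral_const_mul,
      ← integral_add (h1.const_mul _) (h2.const_mul _)]
    refine (integral_congr_ae (.of_forall fun x => ?_)).trans hq1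
    have := (mixture_pos (ha0 x) (hb0 x) hc).ne'
    field_simp
  obtain ⟨c₁, hc₁, h1⟩ := exists_one_le_integral_mul_div_mixture hS ha hb hqm ha0 hb0 hq0 haI hbI
    hqI ha1 hb1 hq1 hord
  obtain ⟨c₂, hc₂, h2⟩ := exists_one_le_integral_mul_div_mixture hS hb ha hqm hb0 ha0 hq0 hbI haI
    hqI hb1 ha1 hq1 hord'
  have h2' : 1 ≤ ∫ x, q x * a x / ((1 - c₂) * a x + (1 - (1 - c₂)) * b x) ∂ν := by
    convert h2 using 3 with x
    ring
  have h1' : ∫ x, q x * a x / (c₁ * a x + (1 - c₁) * b x) ∂ν ≤ 1 := by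
    have := hsum c₁ hc₁
    have h3 : 0 < 1 - c₁ := by linarith [hc₁.2]
    nlinarith [hc₁.1]
  obtain ⟨c, hc, h⟩ := isPreconnected_Ioo.intermediate_value hc₁ (hmem c₂ hc₂)
    (continuousOn_integral_mul_div_mixture ha hb hqI ha0 hb0 hq0) ⟨h1', h2'⟩
  refine ⟨c, hc, h, ?_⟩
  have h3 := hsum c hc
  dsimp only at h
  rw [h] at h3
  have h4 : 0 < 1 - c := by linarith [hc.2]
  exact mul_left_cancel₀ h4.ne' (by linarith)

/-! ### Densities of a totally positive family -/

lemma IsSTP.pos {r : ℕ} (hr : 1 ≤ r) {M X : Type*} [LinearOrder M] [LinearOrder X] {p : M → X → ℝ}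
    (h : IsSTP r p) (μ : M) (x : X) : 0 < p μ x := by
  simpa using h 1 le_rfl hr (fun _ => μ) (fun _ => x) (Subsingleton.strictMono _)
    (Subsingleton.strictMono _)

lemma IsSTP.minor_two {r : ℕ} (hr : 2 ≤ r) {M X : Type*} [LinearOrder M] [LinearOrder X]
    {p : M → X → ℝ} (h : IsSTP r p) {μ₁ μ₂ : M} (hμ : μ₁ < μ₂) {x y : X} (hx : x < y) :
    0 < p μ₁ x * p μ₂ y - p μ₁ y * p μ₂ x := by
  simpa [Matrix.det_fin_two] using h 2 (by norm_num) hr ![μ₁, μ₂] ![x, y]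
    (by simpa [Fin.strictMono_iff_lt_succ] using hμ) (by simpa [Fin.strictMono_iff_lt_succ] using hx)

lemma IsSTP.minor_three {r : ℕ} (hr : 3 ≤ r) {M X : Type*} [LinearOrder M] [LinearOrder X]
    {p : M → X → ℝ} (h : IsSTP r p) {μ₁ μ₂ μ₃ : M} (h12 : μ₁ < μ₂) (h23 : μ₂ < μ₃) {x y z : X}
    (hxy : x < y) (hyz : y < z) :
    0 < p μ₁ x * (p μ₂ y * p μ₃ z - p μ₂ z * p μ₃ y) - p μ₁ y * (p μ₂ x * p μ₃ z - p μ₂ z * p μ₃ x)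
      + p μ₁ z * (p μ₂ x * p μ₃ y - p μ₂ y * p μ₃ x) := by
  have := h 3 (by norm_num) hr ![μ₁, μ₂, μ₃] ![x, y, z]
    (by simp [Fin.strictMono_iff_lt_succ, Fin.forall_fin_two, h12, h23])
    (by simp [Fin.strictMono_iff_lt_succ, Fin.forall_fin_two, hxy, hyz])
  simp [Matrix.det_fin_three] at this
  linarith

lemma integrable_density {X : Type*} [MeasurableSpace X] {ν P : Measure X}
    [IsProbabilityMeasure P] {a : X → ℝ} (ha : Measurable a) (ha0 : ∀ x, 0 ≤ a x)
    (hP : P = ν.withDensity fun x => ENNReal.ofReal (a x)) :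
    Integrable a ν ∧ ∫ x, a x ∂ν = 1 := by
  have h1 : ∫⁻ x, ENNReal.ofReal (a x) ∂ν = 1 := by
    rw [← measure_univ (μ := P), hP, withDensity_apply _ .univ, Measure.restrict_univ]
  have hI : Integrable a ν := by
    refine ⟨ha.aestronglyMeasurable, ?_⟩
    rw [hasFiniteIntegral_iff_ofReal (.of_forall ha0), h1]
    exact ENNReal.one_lt_top
  refine ⟨hI, ?_⟩
  rw [integral_eq_lintegral_of_nonneg_ae (.of_forall ha0) ha.aestronglyMeasurable, h1,
    ENNReal.toReal_one]

lemma lintegral_ofReal_withDensity {X : Type*} [MeasurableSpace X] {ν : Measure X} {a g : X → ℝ}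
    (ha : Measurable a) (hg : Measurable g) (ha0 : ∀ x, 0 ≤ a x) :
    ∫⁻ x, ENNReal.ofReal (g x) ∂(ν.withDensity fun x => ENNReal.ofReal (a x)) =
      ∫⁻ x, ENNReal.ofReal (a x * g x) ∂ν := by
  rw [lintegral_withDensity_eq_lintegral_mul _ (by fun_prop) (by fun_prop)]
  simp [ENNReal.ofReal_mul (ha0 _)]

lemma measurable_of_density {M X : Type*} [MeasurableSpace M] [MeasurableSpace X] {ν : Measure X}
    [SFinite ν] {p : M → X → ℝ} (hp : Measurable (Function.uncurry p)) {P : M → Measure X}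
    (hP : ∀ μ, P μ = ν.withDensity fun x => ENNReal.ofReal (p μ x)) : Measurable P := by
  refine Measure.measurable_of_measurable_coe _ fun s hs => ?_
  simp_rw [hP, withDensity_apply _ hs]
  exact Measurable.lintegral_prod_right' (f := fun z : M × X => ENNReal.ofReal (p z.1 z.2))
    (ENNReal.measurable_ofReal.comp hp)

/-- Any density of the mixture is almost everywhere the mixture of the densities. -/
lemma ae_density_bind_eq_integral {M X : Type*} [MeasurableSpace M] [MeasurableSpace X]
    {ν : Measure X} [SigmaFinite ν] {p : M → X → ℝ} (hp : Measurable (Function.uncurry p))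
    (hp0 : ∀ μ x, 0 ≤ p μ x) {P : M → Measure X}
    (hP : ∀ μ, P μ = ν.withDensity fun x => ENNReal.ofReal (p μ x))
    {w : Measure M} [IsProbabilityMeasure w] {q : X → ℝ} (hqm : Measurable q) (hq0 : ∀ x, 0 ≤ q x)
    (hq : w.bind P = ν.withDensity fun x => ENNReal.ofReal (q x)) :
    ∀ᵐ x ∂ν, Integrable (fun μ => p μ x) w ∧ q x = ∫ μ, p μ x ∂w := by
  have hu : Measurable fun z : M × X => ENNReal.ofReal (p z.1 z.2) :=
    ENNReal.measurable_ofReal.comp hp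
  have hPm := measurable_of_density hp hP
  have hmix : ν.withDensity (fun x => ENNReal.ofReal (q x)) =
      ν.withDensity fun x => ∫⁻ μ, ENNReal.ofReal (p μ x) ∂w := by
    rw [← hq]
    ext s hs
    rw [Measure.bind_apply hs hPm.aemeasurable, withDensity_apply _ hs]
    simp_rw [hP, withDensity_apply _ hs]
    exact lintegral_lintegral_swap (f := fun μ x => ENNReal.ofReal (p μ x)) hu.aemeasurable
  have hae := (withDensity_eq_iff_of_sigmaFinite (by fun_prop)
    (hu.lintegral_prod_left' (μ := w)).aemeasurable).1 hmix
  filter_upwards [hae] with x hx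
  have hpx : Measurable fun μ => p μ x := hp.comp (measurable_id.prodMk measurable_const)
  refine ⟨⟨hpx.aestronglyMeasurable, ?_⟩, ?_⟩
  · rw [hasFiniteIntegral_iff_ofReal (.of_forall fun μ => hp0 μ x), ← hx]
    exact ENNReal.ofReal_lt_top
  · rw [integral_eq_lintegral_of_nonneg_ae (.of_forall fun μ => hp0 μ x) hpx.aestronglyMeasurable,
      ← hx, ENNReal.toReal_ofReal (hq0 x)]

lemma integral_pos_of_ae_pos {M : Type*} [MeasurableSpace M] {w : Measure M}
    [IsProbabilityMeasure w] {g : M → ℝ} (hg : Integrable g w) (h : ∀ᵐ μ ∂w, 0 < g μ) :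
    0 < ∫ μ, g μ ∂w := by
  have hnn : 0 ≤ᵐ[w] g := h.mono fun μ hμ => hμ.le
  refine (integral_nonneg_of_ae hnn).lt_of_ne' fun h0 => ?_
  obtain ⟨μ, h1, h2⟩ := (h.and ((integral_eq_zero_iff_of_nonneg_ae hnn hg).1 h0)).exists
  exact h1.ne' h2

/-! #### Minors with the mixture in place of an intermediate density -/

section Mixture

variable {M X : Type*} [LinearOrder M] [LinearOrder X] [MeasurableSpace M] {p : M → X → ℝ}
  {w : Measure M} [IsProbabilityMeasure w] {Δm Δp : M}

lemma mixture_minor_left (hSTP : IsSTP 3 p) (hw : ∀ᵐ μ ∂w, Δm < μ ∧ μ < Δp) {x y : X}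
    (hxy : x < y) (hx : Integrable (fun μ => p μ x) w) (hy : Integrable (fun μ => p μ y) w) :
    0 < p Δm x * (∫ μ, p μ y ∂w) - p Δm y * ∫ μ, p μ x ∂w := by
  rw [← integral_const_mul, ← integral_const_mul, ← integral_sub (hy.const_mul _) (hx.const_mul _)]
  exact integral_pos_of_ae_pos ((hy.const_mul _).sub (hx.const_mul _))
    (hw.mono fun μ hμ => hSTP.minor_two (by norm_num) hμ.1 hxy)

lemma mixture_minor_right (hSTP : IsSTP 3 p) (hw : ∀ᵐ μ ∂w, Δm < μ ∧ μ < Δp) {x y : X}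
    (hxy : x < y) (hx : Integrable (fun μ => p μ x) w) (hy : Integrable (fun μ => p μ y) w) :
    0 < (∫ μ, p μ x ∂w) * p Δp y - (∫ μ, p μ y ∂w) * p Δp x := by
  rw [← integral_mul_const, ← integral_mul_const, ← integral_sub (hx.mul_const _) (hy.mul_const _)]
  exact integral_pos_of_ae_pos ((hx.mul_const _).sub (hy.mul_const _))
    (hw.mono fun μ hμ => hSTP.minor_two (by norm_num) hμ.2 hxy)

lemma mixture_minor_middle (hSTP : IsSTP 3 p) (hw : ∀ᵐ μ ∂w, Δm < μ ∧ μ < Δp) {x y z : X}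
    (hxy : x < y) (hyz : y < z) (hx : Integrable (fun μ => p μ x) w)
    (hy : Integrable (fun μ => p μ y) w) (hz : Integrable (fun μ => p μ z) w) :
    (∫ μ, p μ x ∂w) * (p Δm y * p Δp z - p Δm z * p Δp y)
      + (∫ μ, p μ z ∂w) * (p Δm x * p Δp y - p Δm y * p Δp x)
      < (∫ μ, p μ y ∂w) * (p Δm x * p Δp z - p Δm z * p Δp x) := by
  have hxz : Integrable (fun μ => p μ x * (p Δm y * p Δp z - p Δm z * p Δp y)
      + p μ z * (p Δm x * p Δp y - p Δm y * p Δp x)) w := (hx.mul_const _).add (hz.mul_const _)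
  rw [← sub_pos, ← integral_mul_const, ← integral_mul_const, ← integral_mul_const,
    ← integral_add (hx.mul_const _) (hz.mul_const _), ← integral_sub (hy.mul_const _) hxz]
  refine integral_pos_of_ae_pos ((hy.mul_const _).sub hxz) (hw.mono fun μ hμ => ?_)
  have := hSTP.minor_three le_rfl hμ.1 hμ.2 hxy hyz
  linarith

end Mixture

/-! ### The mixture likelihood ratio -/

/-- The likelihood ratio `q / m` against a mixture `m` of two members of the hypothesis is a
numéraire: `E_Q[ε / (q / m)]` is the integral of `ε` over `{q > 0}` under that mixture. -/
lemma lintegral_div_mixtureLR_le_one {X : Type*} [MeasurableSpace X] {ν : Measure X}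
    {a b q : X → ℝ} (ha : Measurable a) (hb : Measurable b) (hq : Measurable q)
    (ha0 : ∀ x, 0 < a x) (hb0 : ∀ x, 0 < b x) (hq0 : ∀ x, 0 ≤ q x) {c : ℝ}
    (hc : c ∈ Set.Ioo (0 : ℝ) 1) {ε : X → ℝ≥0∞} (hε : Measurable ε)
    (hEa : ∫⁻ x, ε x ∂(ν.withDensity fun x => ENNReal.ofReal (a x)) ≤ 1)
    (hEb : ∫⁻ x, ε x ∂(ν.withDensity fun x => ENNReal.ofReal (b x)) ≤ 1) :
    ∫⁻ x, ε x / mixtureLR q a b c x ∂(ν.withDensity fun x => ENNReal.ofReal (q x)) ≤ 1 := by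
  have hm : Measurable (mixtureLR q a b c) := by unfold mixtureLR; fun_prop
  have hc1 : 0 ≤ 1 - c := sub_nonneg.2 hc.2.le
  rw [lintegral_withDensity_eq_lintegral_mul _ (by fun_prop) (by fun_prop)] at hEa hEb ⊢
  calc ∫⁻ x, ((fun x => ENNReal.ofReal (q x)) * fun x => ε x / mixtureLR q a b c x) x ∂ν
      ≤ ∫⁻ x, (ENNReal.ofReal c * (ENNReal.ofReal (a x) * ε x)
          + ENNReal.ofReal (1 - c) * (ENNReal.ofReal (b x) * ε x)) ∂ν := by
        refine lintegral_mono fun x => ?_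
        have hM := mixture_pos (ha0 x) (hb0 x) hc
        rw [Pi.mul_apply, ← mul_assoc, ← mul_assoc, ← ENNReal.ofReal_mul hc.1.le,
          ← ENNReal.ofReal_mul hc1, ← add_mul, ← ENNReal.ofReal_add
            (mul_nonneg hc.1.le (ha0 x).le) (mul_nonneg hc1 (hb0 x).le)]
        rcases (hq0 x).eq_or_lt with h | h
        · simp [← h]
        · refine le_of_eq ?_
          rw [mixtureLR, ENNReal.ofReal_div_of_pos hM, ENNReal.div_eq_inv_mul, ← mul_assoc,
            ENNReal.inv_div (by simp) (by simp [hM]),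
            ENNReal.mul_div_cancel (by simpa using h) (by simp)]
    _ = ENNReal.ofReal c * ∫⁻ x, ENNReal.ofReal (a x) * ε x ∂ν
          + ENNReal.ofReal (1 - c) * ∫⁻ x, ENNReal.ofReal (b x) * ε x ∂ν := by
        rw [lintegral_add_left (by fun_prop), lintegral_const_mul _ (by fun_prop),
          lintegral_const_mul _ (by fun_prop)]
    _ ≤ ENNReal.ofReal c * 1 + ENNReal.ofReal (1 - c) * 1 := by
        gcongr
        · exact hEa
        · exact hEb
    _ = 1 := by
        rw [mul_one, mul_one, ← ENNReal.ofReal_add hc.1.le hc1]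
        simp

/-- The likelihood ratio is bounded: `q / a` increases and `q / b` decreases, so left of any
reference point the ratio is controlled by the first and right of it by the second. Hence the
expected logarithm of the likelihood ratio is finite. -/
lemma exists_div_mixture_le {X : Type*} [LinearOrder X] {a b q : X → ℝ} {S : Set X}
    (hSne : S.Nonempty) (ha0 : ∀ x, 0 < a x) (hb0 : ∀ x, 0 < b x) (hq0 : ∀ x, 0 ≤ q x)
    (hqa : ∀ x ∈ S, ∀ y ∈ S, x < y → 0 < a x * q y - a y * q x)
    (hqb : ∀ x ∈ S, ∀ y ∈ S, x < y → 0 < q x * b y - q y * b x)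
    {c : ℝ} (hc : c ∈ Set.Ioo (0 : ℝ) 1) :
    ∃ K : ℝ, ∀ x ∈ S, q x / (c * a x + (1 - c) * b x) ≤ K := by
  obtain ⟨x₀, hx₀⟩ := hSne
  have h0 := hc.1
  have h1 : 0 < 1 - c := sub_pos.2 hc.2
  refine ⟨q x₀ / (c * a x₀) + q x₀ / ((1 - c) * b x₀), fun x hx => ?_⟩
  have hA : 0 ≤ q x₀ / (c * a x₀) := div_nonneg (hq0 _) (mul_pos h0 (ha0 _)).le
  have hB : 0 ≤ q x₀ / ((1 - c) * b x₀) := div_nonneg (hq0 _) (mul_pos h1 (hb0 _)).le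
  rcases le_or_gt x x₀ with h | h
  · have hle : a x * q x₀ - a x₀ * q x ≥ 0 := by
      rcases h.eq_or_lt with rfl | h
      · linarith
      · exact (hqa x hx x₀ hx₀ h).le
    have : q x / (c * a x + (1 - c) * b x) ≤ q x₀ / (c * a x₀) := by
      rw [div_le_div_iff₀ (mixture_pos (ha0 x) (hb0 x) hc) (mul_pos h0 (ha0 _))]
      nlinarith [mul_nonneg h0.le hle, mul_nonneg (hq0 x₀) (mul_pos h1 (hb0 x)).le]
    linarith
  · have hle := (hqb x₀ hx₀ x hx h).le
    have : q x / (c * a x + (1 - c) * b x) ≤ q x₀ / ((1 - c) * b x₀) := by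
      rw [div_le_div_iff₀ (mixture_pos (ha0 x) (hb0 x) hc) (mul_pos h1 (hb0 _))]
      nlinarith [mul_nonneg h1.le hle, mul_nonneg (hq0 x₀) (mul_pos h0 (ha0 x)).le]
    linarith

lemma lintegral_mixtureLR {X : Type*} [MeasurableSpace X] {ν : Measure X} {a b q r : X → ℝ}
    (ha : Measurable a) (hb : Measurable b) (hq : Measurable q) (hr : Measurable r)
    (hr0 : ∀ x, 0 ≤ r x) (c : ℝ) :
    ∫⁻ x, mixtureLR q a b c x ∂(ν.withDensity fun x => ENNReal.ofReal (r x)) =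
      ∫⁻ x, ENNReal.ofReal (q x * r x / (c * a x + (1 - c) * b x)) ∂ν := by
  simp only [mixtureLR]
  rw [lintegral_ofReal_withDensity hr (by fun_prop) hr0]
  refine lintegral_congr fun x => ?_
  congr 1
  ring

/-- The calibrated likelihood ratio is valid under any density `r` for which the third-order
minors with rows `r, a, b` are nonnegative. This covers parameters on both sides of the null, since
the rows `a, b, r` are a cyclic permutation of `r, a, b`. -/
lemma lintegral_mixtureLR_le_one {X : Type*} [LinearOrder X] [MeasurableSpace X]
    (hIio : ∀ x : X, MeasurableSet (Set.Iio x)) (hIoi : ∀ x : X, MeasurableSet (Set.Ioi x))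
    {ν : Measure X} {a b q r : X → ℝ} {S : Set X} (hS : ∀ᵐ x ∂ν, x ∈ S)
    (ha : Measurable a) (hb : Measurable b) (hq : Measurable q) (hr : Measurable r)
    (ha0 : ∀ x, 0 < a x) (hb0 : ∀ x, 0 < b x) (hq0 : ∀ x, 0 ≤ q x) (hr0 : ∀ x, 0 < r x)
    (haI : Integrable a ν) (hbI : Integrable b ν) (hrI : Integrable r ν)
    (ha1 : ∫ x, a x ∂ν = 1) (hb1 : ∫ x, b x ∂ν = 1) (hr1 : ∫ x, r x ∂ν = 1)
    {c : ℝ} (hc : c ∈ Set.Ioo (0 : ℝ) 1) {K : ℝ}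
    (hK : ∀ x ∈ S, q x / (c * a x + (1 - c) * b x) ≤ K)
    (hEa : ∫⁻ x, mixtureLR q a b c x ∂(ν.withDensity fun x => ENNReal.ofReal (a x)) = 1)
    (hEb : ∫⁻ x, mixtureLR q a b c x ∂(ν.withDensity fun x => ENNReal.ofReal (b x)) = 1)
    (hD2 : ∀ x z, x < z → 0 < a x * b z - a z * b x)
    (hDq : ∀ x ∈ S, ∀ y ∈ S, ∀ z ∈ S, x < y → y < z →
      q x * (a y * b z - a z * b y) + q z * (a x * b y - a y * b x)
        < q y * (a x * b z - a z * b x))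
    (hD3 : ∀ x y z, x < y → y < z → 0 ≤ r x * (a y * b z - a z * b y)
      - r y * (a x * b z - a z * b x) + r z * (a x * b y - a y * b x)) :
    ∫⁻ x, mixtureLR q a b c x ∂(ν.withDensity fun x => ENNReal.ofReal (r x)) ≤ 1 := by
  have hM := fun x => mixture_pos (ha0 x) (hb0 x) hc
  set e : X → ℝ := fun x => q x / (c * a x + (1 - c) * b x) with he
  have hem : Measurable e := by fun_prop
  have he0 : ∀ x, 0 ≤ e x := fun x => div_nonneg (hq0 x) (hM x).le
  have heI : ∀ g : X → ℝ, Integrable g ν → Integrable (fun x => e x * g x) ν := fun g hg =>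
    hg.bdd_mul hem.aestronglyMeasurable (c := K) (hS.mono fun x hx => by
      rw [Real.norm_of_nonneg (he0 x)]; exact hK x hx)
  have hfI : ∀ g : X → ℝ, Integrable g ν → Integrable (fun x => (e x - 1) * g x) ν := fun g hg =>
    ((heI g hg).sub hg).congr (.of_forall fun x => by simp only [Pi.sub_apply]; ring)
  have hfi : ∀ g : X → ℝ, Integrable g ν →
      ∫ x, (e x - 1) * g x ∂ν = ∫ x, e x * g x ∂ν - ∫ x, g x ∂ν := by
    intro g hg
    rw [← integral_sub (heI g hg) hg]
    exact integral_congr_ae (.of_forall fun x => by dsimp only; ring)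
  have hlint : ∀ g : X → ℝ, Measurable g → (∀ x, 0 < g x) → Integrable g ν →
      ∫⁻ x, mixtureLR q a b c x ∂(ν.withDensity fun x => ENNReal.ofReal (g x)) =
        ENNReal.ofReal (∫ x, e x * g x ∂ν) := by
    intro g hg hg0 hgI
    rw [lintegral_mixtureLR ha hb hq hg (fun x => (hg0 x).le), ofReal_integral_eq_lintegral_ofReal
      (heI g hgI) (.of_forall fun x => mul_nonneg (he0 x) (hg0 x).le)]
    refine lintegral_congr fun x => ?_
    congr 1
    simp only [he]
    ring
  rw [hlint a ha ha0 haI, ENNReal.ofReal_eq_one] at hEa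
  rw [hlint b hb hb0 hbI, ENNReal.ofReal_eq_one] at hEb
  have hpos : ∀ x, 0 < e x - 1 ↔ 0 < q x - (c * a x + (1 - c) * b x) := fun x => by
    rw [sub_pos, sub_pos, he, one_lt_div (hM x)]
  have := integral_mul_nonpos_of_sign_pattern hIio hIoi (f := fun x => e x - 1) (r := r) hS hr ha hb
    ha0 (hfI r hrI) (hfI a haI) (hfI b hbI) (by fun_prop) (by rw [hfi a haI, hEa, ha1, sub_self])
    (by rw [hfi b hbI, hEb, hb1, sub_self]) (by
      intro x hx y hy z hz hxy hyz h1 h2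
      rw [hpos] at h1 h2 ⊢
      have h3 := hDq x hx y hy z hz hxy hyz
      -- The `3 × 3` minors with middle row a combination of the outer rows vanish, so
      -- `q` may be replaced by `q - c a - (1 - c) b`.
      have h4 := mul_pos h1 (hD2 y z hyz)
      have h5 := mul_pos h2 (hD2 x y hxy)
      have h6 := hD2 x z (hxy.trans hyz)
      refine pos_of_mul_pos_left (b := a x * b z - a z * b x) ?_ h6.le
      linarith) hD2 hD3
  rw [hlint r hr hr0 hrI]
  rw [hfi r hrI, hr1] at this
  exact ENNReal.ofReal_le_one.2 (by linarith)

theorem corollary5p2 (M X : Set ℝ) (ν : Measure X) [SigmaFinite ν]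
    (p : M → X → ℝ) (hp : Measurable (Function.uncurry p))
    (P : M → Measure X) [∀ μ, IsProbabilityMeasure (P μ)]
    (hP : ∀ μ, P μ = ν.withDensity fun x => ENNReal.ofReal (p μ x))
    (hSTP : IsSTP 3 p)
    (Δm Δp : M) (hΔ : Δm < Δp)
    (w : Measure M) [IsProbabilityMeasure w] (hw : ∀ᵐ μ ∂w, Δm < μ ∧ μ < Δp)
    (Q : Measure X) (hQ : Q = w.bind P)
    (q : X → ℝ) (hqm : Measurable q) (hq0 : ∀ x, 0 ≤ q x)
    (hq : Q = ν.withDensity fun x => ENNReal.ofReal (q x)) :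
    (∃ c ∈ Set.Ioo (0 : ℝ) 1,
      ∫⁻ x, mixtureLR q (p Δm) (p Δp) c x ∂(P Δm) = 1 ∧
        ∫⁻ x, mixtureLR q (p Δm) (p Δp) c x ∂(P Δp) = 1) ∧
    ∀ c ∈ Set.Ioo (0 : ℝ) 1,
      ∫⁻ x, mixtureLR q (p Δm) (p Δp) c x ∂(P Δm) = 1 →
      ∫⁻ x, mixtureLR q (p Δm) (p Δp) c x ∂(P Δp) = 1 →
        IsUtilityOptimal (equivalenceNull P Δm Δp) Q ENNReal.log
            (mixtureLR q (p Δm) (p Δp) c) ∧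
          ∀ ε : X → ℝ≥0∞,
            IsUtilityOptimal (equivalenceNull P Δm Δp) Q ENNReal.log ε →
              ε =ᵐ[Q] mixtureLR q (p Δm) (p Δp) c := by
  have hpm : ∀ μ, Measurable (p μ) := fun μ => hp.comp (measurable_const.prodMk measurable_id)
  have hp0 : ∀ μ x, 0 < p μ x := hSTP.pos (by norm_num)
  have hpI : ∀ μ, Integrable (p μ) ν ∧ ∫ x, p μ x ∂ν = 1 := fun μ =>
    integrable_density (hpm μ) (fun x => (hp0 μ x).le) (hP μ)
  have hQP : IsProbabilityMeasure Q := ⟨by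
    rw [hQ, Measure.bind_apply .univ (measurable_of_density hp hP).aemeasurable]
    simp⟩
  obtain ⟨hqI, hq1⟩ := integrable_density hqm hq0 hq
  set S : Set X := {x | Integrable (fun μ => p μ x) w ∧ q x = ∫ μ, p μ x ∂w} with hSdef
  have hS : ∀ᵐ x ∂ν, x ∈ S :=
    ae_density_bind_eq_integral hp (fun μ x => (hp0 μ x).le) hP hqm hq0 (hQ ▸ hq)
  have hD2 : ∀ x z, x < z → 0 < p Δm x * p Δp z - p Δm z * p Δp x := fun x z =>
    hSTP.minor_two (by norm_num) hΔ
  have hqa : ∀ x ∈ S, ∀ y ∈ S, x < y → 0 < p Δm x * q y - p Δm y * q x := by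
    intro x hx y hy hxy
    rw [hx.2, hy.2]
    exact mixture_minor_left hSTP hw hxy hx.1 hy.1
  have hqb : ∀ x ∈ S, ∀ y ∈ S, x < y → 0 < q x * p Δp y - q y * p Δp x := by
    intro x hx y hy hxy
    rw [hx.2, hy.2]
    exact mixture_minor_right hSTP hw hxy hx.1 hy.1
  have hDq : ∀ x ∈ S, ∀ y ∈ S, ∀ z ∈ S, x < y → y < z →
      q x * (p Δm y * p Δp z - p Δm z * p Δp y) + q z * (p Δm x * p Δp y - p Δm y * p Δp x)
        < q y * (p Δm x * p Δp z - p Δm z * p Δp x) := by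
    intro x hx y hy z hz hxy hyz
    rw [hx.2, hy.2, hz.2]
    exact mixture_minor_middle hSTP hw hxy hyz hx.1 hy.1 hz.1
  refine ⟨?_, fun c hc hEa hEb => ?_⟩
  · have hlt : ∀ x ∈ S, ∀ y ∈ S, x < y →
        0 < (p Δp y / p Δm y - p Δp x / p Δm x) * (q y / p Δm y - q x / p Δm x) ∧
        0 < (p Δm x / p Δp x - p Δm y / p Δp y) * (q x / p Δp x - q y / p Δp y) := by
      intro x hx y hy hxy
      have h1 := hp0 Δm x
      have h2 := hp0 Δm y
      have h3 := hp0 Δp x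
      have h4 := hp0 Δp y
      have h5 := hD2 x y hxy
      have h6 := hqa x hx y hy hxy
      have h7 := hqb x hx y hy hxy
      constructor <;> refine mul_pos (sub_pos.2 ?_) (sub_pos.2 ?_) <;>
        (rw [div_lt_div_iff₀ (by assumption) (by assumption)]; linarith)
    obtain ⟨c, hc, h1, h2⟩ := exists_integral_mul_div_mixture_eq_one hS (hpm Δm) (hpm Δp) hqm
      (hp0 Δm) (hp0 Δp) hq0 (hpI Δm).1 (hpI Δp).1 hqI (hpI Δm).2 (hpI Δp).2 hq1
      (by
        intro x hx y hy hne
        rcases hne.lt_or_gt with h | h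
        · rw [← neg_mul_neg, neg_sub, neg_sub]; exact (hlt x hx y hy h).1
        · exact (hlt y hy x hx h).1)
      (by
        intro x hx y hy hne
        rcases hne.lt_or_gt with h | h
        · exact (hlt x hx y hy h).2
        · rw [← neg_mul_neg, neg_sub, neg_sub]; exact (hlt y hy x hx h).2)
    have hconv : ∀ μ, ∫ x, q x * p μ x / (c * p Δm x + (1 - c) * p Δp x) ∂ν = 1 →
        ∫⁻ x, mixtureLR q (p Δm) (p Δp) c x ∂(P μ) = 1 := by
      intro μ h
      -- A non-integrable function would have Bochner integral zero.
      have hint : Integrable (fun x => q x * p μ x / (c * p Δm x + (1 - c) * p Δp x)) ν :=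
        not_not.1 fun hn => zero_ne_one ((integral_undef hn).symm.trans h)
      rw [hP, lintegral_mixtureLR (hpm Δm) (hpm Δp) hqm (hpm μ) fun x => (hp0 μ x).le,
        ← ofReal_integral_eq_lintegral_ofReal hint (.of_forall fun x =>
          div_nonneg (mul_nonneg (hq0 x) (hp0 μ x).le)
            (mixture_pos (hp0 Δm x) (hp0 Δp x) hc).le), h, ENNReal.ofReal_one]
    exact ⟨c, hc, hconv Δm h1, hconv Δp h2⟩
  · have hνne : ν ≠ 0 := by
      rintro rfl
      simp at hq1
    have : (ae ν).NeBot := ae_neBot.2 hνne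
    obtain ⟨K, hK⟩ := exists_div_mixture_le (hS.exists) (hp0 Δm) (hp0 Δp) hq0 hqa hqb hc
    have hm : Measurable (mixtureLR q (p Δm) (p Δp) c) := by
      have := hpm Δm
      have := hpm Δp
      unfold mixtureLR
      fun_prop
    have hQν : Q ≪ ν := hq ▸ withDensity_absolutelyContinuous _ _
    refine isUtilityOptimal_log_of_numeraire ?_ ⟨hm, ?_⟩ ?_ (K := ENNReal.ofReal K)
      ENNReal.ofReal_ne_top ?_ ?_
    · rintro _ ⟨μ, -, rfl⟩
      infer_instance
    · rintro _ ⟨μ, hμ, rfl⟩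
      rw [hP] at hEa hEb ⊢
      have hval := lintegral_mixtureLR_le_one (fun _ => measurableSet_Iio)
        (fun _ => measurableSet_Ioi) hS (hpm Δm) (hpm Δp) hqm (hpm μ) (hp0 Δm) (hp0 Δp) hq0
        (hp0 μ) (hpI Δm).1 (hpI Δp).1 (hpI μ).1 (hpI Δm).2 (hpI Δp).2 (hpI μ).2 hc hK hEa hEb hD2
        hDq
      rcases hμ with hμ | hμ
      · rcases hμ.eq_or_lt with rfl | hμ
        · exact hEa.le
        · exact hval fun x y z hxy hyz => (hSTP.minor_three le_rfl hμ hΔ hxy hyz).le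
      · rcases hμ.eq_or_lt with rfl | hμ
        · exact hEb.le
        · -- Moving the row of `μ` from last to first place is an even permutation.
          refine hval fun x y z hxy hyz => ?_
          have := hSTP.minor_three le_rfl hΔ hμ hxy hyz
          linarith
    · have hqpos : ∀ᵐ x ∂Q, 0 < q x := by
        rw [hq, ae_withDensity_iff (by fun_prop)]
        exact .of_forall fun x hx => by simpa using hx
      filter_upwards [hqpos] with x hx
      have := div_pos hx (mixture_pos (hp0 Δm x) (hp0 Δp x) hc)
      simpa [mixtureLR] using this
    · filter_upwards [hQν hS] with x hx
      exact ENNReal.ofReal_le_ofReal (hK x hx)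
    · intro ε' hε'
      rw [hq]
      refine lintegral_div_mixtureLR_le_one (hpm Δm) (hpm Δp) hqm (hp0 Δm) (hp0 Δp) hq0 hc hε'.1 ?_ ?_
      · rw [← hP]
        exact hε'.2 _ ⟨Δm, Or.inl le_rfl, rfl⟩
      · rw [← hP]
        exact hε'.2 _ ⟨Δp, Or.inr le_rfl, rfl⟩
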